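/- For $n\ge 0$ let $SG_4(n)$ be the four-dimensional Sierpinski gasket graph at stage $n$: $SG_4(0)$ is the complete graph on the five vertices of a 4-simplex (its outmost vertices), and $SG_4(n+1)$ is the juxtaposition of five copies of $SG_4(n)$, one at each corner of a 4-simplex of twice the side length, any two copies being glued at exactly one outmost vertex of each; the five outmost vertices of $SG_4(n+1)$ are the corners of the larger simplex. For a finite graph $G$ let $v(G)$ be its number of vertices and let $N_{DM}(G)$ be its number of dimer-monomer configurations, i.e. the number of matchings of $G$ (sets of pairwise vertex-disjoint edges, the dimers, including the empty set; the uncovered vertices are monomers). Then the asymptotic growth constant $$z_{SG_4}=\lim_{n\to\infty}\frac{\ln N_{DM}(SG_4(n))}{v(SG_4(n))}$$ exists, and its decimal expansion begins $z_{SG_4}=0.876779402949\ldots$, that is, $0.876779402949\le z_{SG_4}<0.876779402950$. -/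

import Mathlib

/-- The vertices of the `d`-dimensional Sierpinski gasket at stage `n`, in barycentric lattice
coordinates of a regular `d`-simplex of side length `2 ^ n` (points of `ℕ ^ (d + 1)` with coordinate
sum `2 ^ n`). Stage `0` is the set of the `d + 1` corners of the unit simplex. Stage `n + 1` is the
juxtaposition of `d + 1` translated copies of stage `n`, one at each corner of the simplex of
twice the size; two different copies share exactly one vertex, an outmost vertex of each. -/
def sierpinskiVerts (d : ℕ) : ℕ → Finset (Fin (d + 1) → ℕ)
  | 0 => Finset.univ.image fun i => Pi.single i 1
  | n + 1 => Finset.univ.biUnion fun i =>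
      (sierpinskiVerts d n).image fun x => x + Pi.single i (2 ^ n)

/-- The adjacency of the Sierpinski gasket, as a graph on the ambient lattice: at stage `0` the
complete graph on the `d + 1` corners of the unit simplex, at stage `n + 1` the union of the `d + 1`
translated copies of stage `n`. -/
def sierpinskiLatticeGraph (d : ℕ) : ℕ → SimpleGraph (Fin (d + 1) → ℕ)
  | 0 => (⊤ : SimpleGraph (Fin (d + 1))).map fun i => Pi.single i 1
  | n + 1 => ⨆ i : Fin (d + 1),
      (sierpinskiLatticeGraph d n).map fun x => x + Pi.single i (2 ^ n)

/-- The Sierpinski gasket `SG_d(n)`, a graph on its finite vertex set. -/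
def sierpinskiGasket (d n : ℕ) : SimpleGraph (sierpinskiVerts d n) :=
  (sierpinskiLatticeGraph d n).comap Subtype.val

/-- The number `N_DM(G)` of dimer-monomer configurations of `G`: the number of ways to place dimers
on edges so that no vertex is covered twice (the uncovered vertices are the monomers), that is,
the number of matchings of `G`, the empty one included. -/
noncomputable def numDimerMonomers {V : Type*} (G : SimpleGraph V) : ℕ :=
  Nat.card {M : G.Subgraph // M.IsMatching}

/-- `z` is the asymptotic growth constant of dimer-monomers on `SG_d`: the limit, as the stage
`n` tends to infinity, of `ln N_DM(SG_d(n)) / v(SG_d(n))`, `v` being the number of vertices. -/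
def IsDimerMonomerGrowthConstant (d : ℕ) (z : ℝ) : Prop :=
  Filter.Tendsto
    (fun n : ℕ => Real.log (numDimerMonomers (sierpinskiGasket d n) : ℝ) /
      (Nat.card (sierpinskiVerts d n) : ℝ))
    Filter.atTop (nhds z)

open Finset

/-! Weight each matching of stage `n` by `2` to the number of corners it covers, admitting only
those that cover no corner outside `S`; the total is `cornerSum d n S`. Stage `n + 1` glues its
copies at one vertex per pair `i, j`, and the only constraint is that this vertex is not covered
from both sides. By `cornerWeight_add`, twice the indicator of that constraint is `w(may) w(may not)
+ w(may not) w(may)`. Expanding the product over pairs gives a sum over tournaments, hence the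
positive recursion `card_orientations_mul_cornerSum_succ`.

For `i ∉ S`, replacing `S` by `insert i S` changes only the factor of copy `i` in each term. So
ratios of corner sums at stage `n + 1` are weighted means of ratios at stage `n`, and an interval
`[m, M]` containing them all persists (`CornerRatioBounds.succ`). A tournament on five vertices has
total score 10, so the sums `c` for `S = ∅` satisfy `m ^ 10 * c ^ 5 ≤ c' ≤ M ^ 10 * c ^ 5` from each
stage to the next. Thus `ln c / 5 ^ n` converges with explicit error, and `N_DM` differs from `c` by
a bounded factor.

Exact evaluation through stage 4 gives `M - m = 10 ^ (-13)`, which moves `z` by less than `10 ^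
(-16)`. The decimals then follow from comparisons of integers. -/

/-- `G.IsDimerConfig H`: the edges of `H` form a matching of `G`. -/
def SimpleGraph.IsDimerConfig {W : Type*} (G H : SimpleGraph W) : Prop :=
  H ≤ G ∧ ∀ ⦃a b c⦄, H.Adj a b → H.Adj a c → b = c

/-- The `i`-th corner of the simplex of side `2 ^ n`. -/
def sierpinskiCorner (d n : ℕ) (i : Fin (d + 1)) : Fin (d + 1) → ℕ := Pi.single i (2 ^ n)

/-- The translation onto the `i`-th copy of stage `n` inside stage `n + 1`. -/
def sierpinskiShift (d n : ℕ) (i : Fin (d + 1)) : (Fin (d + 1) → ℕ) ↪ (Fin (d + 1) → ℕ) :=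
  addRightEmbedding (sierpinskiCorner d n i)

/-! ### Geometry of the copies in the lattice. -/

section Lattice

variable {d n : ℕ}

@[simp] lemma sierpinskiShift_apply (i : Fin (d + 1)) (x : Fin (d + 1) → ℕ) :
    sierpinskiShift d n i x = x + sierpinskiCorner d n i := rfl

lemma sierpinskiLatticeGraph_succ :
    sierpinskiLatticeGraph d (n + 1) =
      ⨆ i, (sierpinskiLatticeGraph d n).map (sierpinskiShift d n i) := rfl

lemma sierpinskiVerts_succ :
    sierpinskiVerts d (n + 1) =
      univ.biUnion fun i => (sierpinskiVerts d n).map (sierpinskiShift d n i) := by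
  simp only [sierpinskiVerts, Finset.map_eq_image]
  rfl

lemma sierpinskiCorner_succ (i : Fin (d + 1)) :
    sierpinskiCorner d (n + 1) i = sierpinskiCorner d n i + sierpinskiCorner d n i := by
  simp only [sierpinskiCorner, ← Pi.single_add]
  congr 1
  ring

lemma sum_of_mem_sierpinskiVerts {x : Fin (d + 1) → ℕ} (hx : x ∈ sierpinskiVerts d n) :
    ∑ k, x k = 2 ^ n := by
  induction n generalizing x with
  | zero =>
    obtain ⟨i, -, rfl⟩ := Finset.mem_image.1 hx
    simp
  | succ n ih =>
    rw [sierpinskiVerts_succ] at hx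
    simp only [mem_biUnion, mem_univ, true_and, Finset.mem_map, sierpinskiShift_apply] at hx
    obtain ⟨i, y, hy, rfl⟩ := hx
    simp [sum_add_distrib, ih hy, sierpinskiCorner, pow_succ, mul_two]

lemma mem_sierpinskiVerts_of_adj {x y : Fin (d + 1) → ℕ}
    (h : (sierpinskiLatticeGraph d n).Adj x y) : x ∈ sierpinskiVerts d n := by
  induction n generalizing x y with
  | zero =>
    obtain ⟨-, u, v, -, rfl, rfl⟩ := h
    simp [sierpinskiVerts]
  | succ n ih =>
    rw [sierpinskiLatticeGraph_succ, SimpleGraph.iSup_adj] at h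
    obtain ⟨i, h⟩ := h
    obtain ⟨u, v, huv, rfl, rfl⟩ := (SimpleGraph.map_adj _ _ _ _).1 h
    rw [sierpinskiVerts_succ]
    simp only [mem_biUnion, mem_univ, true_and, Finset.mem_map]
    exact ⟨i, u, ih huv, rfl⟩

lemma sierpinskiCorner_mem (i : Fin (d + 1)) : sierpinskiCorner d n i ∈ sierpinskiVerts d n := by
  induction n with
  | zero => simp [sierpinskiVerts, sierpinskiCorner]
  | succ n ih =>
    rw [sierpinskiVerts_succ]
    simp only [mem_biUnion, mem_univ, true_and, Finset.mem_map]
    exact ⟨i, _, ih, (sierpinskiCorner_succ i).symm⟩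

/-- A coordinate that exhausts the coordinate sum forces the others to vanish. -/
lemma eq_sierpinskiCorner_of_le {x : Fin (d + 1) → ℕ} {i : Fin (d + 1)}
    (hx : ∑ k, x k = 2 ^ n) (hi : 2 ^ n ≤ x i) : x = sierpinskiCorner d n i := by
  have h1 := Finset.add_sum_erase univ x (mem_univ i)
  have h2 : ∑ k ∈ univ.erase i, x k = 0 := by omega
  funext k
  by_cases hk : k = i
  · subst hk
    simp only [sierpinskiCorner, Pi.single_eq_same]
    omega
  · rw [Finset.sum_eq_zero_iff] at h2
    simpa [sierpinskiCorner, Pi.single_eq_of_ne hk] using h2 k (by simp [hk])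

/-- Two different copies of stage `n` meet only in the corner they share. -/
lemma eq_sierpinskiCorner_of_shift_eq {x y : Fin (d + 1) → ℕ} {i j : Fin (d + 1)}
    (hij : i ≠ j) (hx : x ∈ sierpinskiVerts d n)
    (h : x + sierpinskiCorner d n i = y + sierpinskiCorner d n j) :
    x = sierpinskiCorner d n j := by
  apply eq_sierpinskiCorner_of_le (sum_of_mem_sierpinskiVerts hx)
  -- Coordinate `j` reads `x j = y j + 2 ^ n`, so `x j` is at least `2 ^ n`.
  have := congrFun h j
  simp [sierpinskiCorner, Pi.single_eq_of_ne hij.symm] at this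
  omega

lemma sierpinskiCorner_ne {i j : Fin (d + 1)} (hij : i ≠ j) :
    sierpinskiCorner d n i ≠ sierpinskiCorner d n j := by
  intro h
  have := congrFun h i
  simp [sierpinskiCorner, Pi.single_eq_of_ne hij] at this

end Lattice

/-! ### Matchings of stage `n + 1` as compatible families of matchings of stage `n`. -/

/-- The matchings of the gasket at stage `n`, as graphs on the ambient lattice. -/
noncomputable def sierpinskiDimers (d n : ℕ) : Finset (SimpleGraph (Fin (d + 1) → ℕ)) :=
  Set.Finite.toFinset (s := {H | (sierpinskiLatticeGraph d n).IsDimerConfig H}) <| by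
    classical
    refine Set.Finite.subset (Set.Finite.preimage (f := SimpleGraph.edgeSet)
      SimpleGraph.edgeSet_injective.injOn
      ((sierpinskiVerts d n).sym2.finite_toSet.finite_subsets)) ?_
    intro H hH e he
    induction e with
    | h x y =>
      have := hH.1 he
      simpa using ⟨mem_sierpinskiVerts_of_adj this, mem_sierpinskiVerts_of_adj this.symm⟩

/-- The copies `h i` of subgraphs of stage `n` put together inside stage `n + 1`. -/
def sierpinskiGlue (d n : ℕ) (h : Fin (d + 1) → SimpleGraph (Fin (d + 1) → ℕ)) :
    SimpleGraph (Fin (d + 1) → ℕ) :=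
  ⨆ i, (h i).map (sierpinskiShift d n i)

open Classical in
/-- The corners covered by the configuration `H`. -/
noncomputable def coveredCorners (d n : ℕ) (H : SimpleGraph (Fin (d + 1) → ℕ)) :
    Finset (Fin (d + 1)) :=
  univ.filter fun i => sierpinskiCorner d n i ∈ H.support

section Glue

variable {d n : ℕ} {h : Fin (d + 1) → SimpleGraph (Fin (d + 1) → ℕ)}

@[simp] lemma mem_sierpinskiDimers {H : SimpleGraph (Fin (d + 1) → ℕ)} :
    H ∈ sierpinskiDimers d n ↔ (sierpinskiLatticeGraph d n).IsDimerConfig H := by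
  simp [sierpinskiDimers]

lemma mem_coveredCorners {H : SimpleGraph (Fin (d + 1) → ℕ)} {i : Fin (d + 1)} :
    i ∈ coveredCorners d n H ↔ ∃ y, H.Adj (sierpinskiCorner d n i) y := by
  simp [coveredCorners, SimpleGraph.mem_support]

lemma sierpinskiGlue_adj {a b : Fin (d + 1) → ℕ} :
    (sierpinskiGlue d n h).Adj a b ↔ ∃ i x y, (h i).Adj x y ∧
      x + sierpinskiCorner d n i = a ∧ y + sierpinskiCorner d n i = b := by
  simp only [sierpinskiGlue, SimpleGraph.iSup_adj, SimpleGraph.map_adj, sierpinskiShift_apply]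

/-- An edge of stage `n + 1` belongs to only one of the copies of stage `n`. -/
lemma sierpinskiShift_index_unique {i j : Fin (d + 1)} {x y x' y' : Fin (d + 1) → ℕ}
    (hxy : (sierpinskiLatticeGraph d n).Adj x y)
    (h1 : x + sierpinskiCorner d n i = x' + sierpinskiCorner d n j)
    (h2 : y + sierpinskiCorner d n i = y' + sierpinskiCorner d n j) : i = j := by
  by_contra hij
  -- Otherwise both ends of the edge would be the single vertex common to the two copies.
  apply hxy.ne
  rw [eq_sierpinskiCorner_of_shift_eq hij (mem_sierpinskiVerts_of_adj hxy) h1,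
    eq_sierpinskiCorner_of_shift_eq hij (mem_sierpinskiVerts_of_adj hxy.symm) h2]

lemma sierpinskiGlue_adj_shift {i : Fin (d + 1)}
    {x y : Fin (d + 1) → ℕ} (hxy : (sierpinskiLatticeGraph d n).Adj x y) :
    (sierpinskiGlue d n h).Adj (x + sierpinskiCorner d n i) (y + sierpinskiCorner d n i) ↔
      (h i).Adj x y := by
  rw [sierpinskiGlue_adj]
  constructor
  · rintro ⟨j, x', y', hj, h1, h2⟩
    obtain rfl := sierpinskiShift_index_unique hxy h1.symm h2.symm
    rwa [← add_right_cancel h1, ← add_right_cancel h2]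
  · exact fun H => ⟨i, x, y, H, rfl, rfl⟩

/-- An outmost corner of stage `n + 1` lies in one copy only, so no other copy can cover it. -/
lemma coveredCorners_sierpinskiGlue (hh : ∀ i, h i ≤ sierpinskiLatticeGraph d n)
    {i : Fin (d + 1)} : i ∈ coveredCorners d (n + 1) (sierpinskiGlue d n h) ↔
      i ∈ coveredCorners d n (h i) := by
  simp only [mem_coveredCorners, sierpinskiGlue_adj, sierpinskiCorner_succ]
  constructor
  · rintro ⟨b, j, x, y, hxy, h1, -⟩
    have hx := mem_sierpinskiVerts_of_adj (hh j hxy)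
    by_cases hij : j = i
    · subst hij
      exact ⟨y, (add_right_cancel h1) ▸ hxy⟩
    · exact absurd (eq_sierpinskiCorner_of_shift_eq (Ne.symm hij)
        (sierpinskiCorner_mem i) h1.symm) (sierpinskiCorner_ne (Ne.symm hij))
  · rintro ⟨y, hy⟩
    exact ⟨_, i, _, y, hy, rfl, rfl⟩

lemma sierpinskiGlue_injOn :
    Set.InjOn (sierpinskiGlue d n) {h | ∀ i, h i ≤ sierpinskiLatticeGraph d n} := by
  intro h hh h' hh' e
  funext i
  ext x y
  constructor
  · intro hxy
    have := hh i hxy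
    rwa [← sierpinskiGlue_adj_shift this, ← e, sierpinskiGlue_adj_shift this]
  · intro hxy
    have := hh' i hxy
    rwa [← sierpinskiGlue_adj_shift this, e, sierpinskiGlue_adj_shift this]

/-- Two edges at one vertex either lie in the same copy, where the matching property applies, or
meet at the vertex shared by copies `i` and `j`: corner `j` of copy `i` and corner `i` of copy `j`.
Hypothesis `hc` excludes the second case. -/
lemma sierpinskiGlue_mem (hh : ∀ i, h i ∈ sierpinskiDimers d n)
    (hc : ∀ i j, i ≠ j → ¬ (j ∈ coveredCorners d n (h i) ∧ i ∈ coveredCorners d n (h j))) :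
    sierpinskiGlue d n h ∈ sierpinskiDimers d (n + 1) := by
  simp only [mem_sierpinskiDimers] at hh ⊢
  refine ⟨iSup_mono fun i => SimpleGraph.map_monotone _ (hh i).1, ?_⟩
  intro a b c hab hac
  rw [sierpinskiGlue_adj] at hab hac
  obtain ⟨i, x, y, hxy, rfl, rfl⟩ := hab
  obtain ⟨j, x', y', hxy', h1, rfl⟩ := hac
  by_cases hij : i = j
  · subst hij
    obtain rfl := add_right_cancel h1
    rw [(hh i).2 hxy hxy']
  · exfalso
    have hx := eq_sierpinskiCorner_of_shift_eq hij
      (mem_sierpinskiVerts_of_adj ((hh i).1 hxy)) h1.symm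
    have hx' := eq_sierpinskiCorner_of_shift_eq (Ne.symm hij)
      (mem_sierpinskiVerts_of_adj ((hh j).1 hxy')) h1
    exact hc i j hij ⟨mem_coveredCorners.2 ⟨y, hx ▸ hxy⟩, mem_coveredCorners.2 ⟨y', hx' ▸ hxy'⟩⟩

/-- Restrict `H` to each copy. If a shared vertex were covered from both sides, the two edges would
coincide in `H`, although an edge belongs to only one copy. -/
lemma exists_sierpinskiGlue {H : SimpleGraph (Fin (d + 1) → ℕ)}
    (hH : H ∈ sierpinskiDimers d (n + 1)) :
    ∃ h : Fin (d + 1) → SimpleGraph (Fin (d + 1) → ℕ), (∀ i, h i ∈ sierpinskiDimers d n) ∧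
      (∀ i j, i ≠ j → ¬ (j ∈ coveredCorners d n (h i) ∧ i ∈ coveredCorners d n (h j))) ∧
      sierpinskiGlue d n h = H := by
  simp only [mem_sierpinskiDimers] at hH ⊢
  refine ⟨fun i => sierpinskiLatticeGraph d n ⊓ H.comap (sierpinskiShift d n i), ?_, ?_, ?_⟩
  · intro i
    refine ⟨inf_le_left, fun a b c hab hac => ?_⟩
    exact add_right_cancel (hH.2 hab.2 hac.2)
  · rintro i j hij ⟨h1, h2⟩
    obtain ⟨y, hy, hy'⟩ := mem_coveredCorners.1 h1
    obtain ⟨z, hz, hz'⟩ := mem_coveredCorners.1 h2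
    simp only [SimpleGraph.comap_adj, sierpinskiShift_apply] at hy' hz'
    rw [add_comm (sierpinskiCorner d n i)] at hz'
    have := hH.2 hy' hz'
    exact hij (sierpinskiShift_index_unique hy (add_comm _ _) this)
  · ext a b
    rw [sierpinskiGlue_adj]
    constructor
    · rintro ⟨i, x, y, ⟨-, hxy⟩, rfl, rfl⟩
      exact hxy
    · intro hab
      have := hH.1 hab
      rw [sierpinskiLatticeGraph_succ, SimpleGraph.iSup_adj] at this
      obtain ⟨i, hi⟩ := this
      obtain ⟨u, v, huv, rfl, rfl⟩ := (SimpleGraph.map_adj _ _ _ _).1 hi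
      exact ⟨i, u, v, ⟨huv, hab⟩, rfl, rfl⟩

open Classical in
/-- A sum over the matchings of stage `n + 1` as a sum over compatible families of matchings of
stage `n`. -/
lemma sum_sierpinskiDimers_succ {M : Type*} [AddCommMonoid M]
    (F : SimpleGraph (Fin (d + 1) → ℕ) → M) :
    ∑ H ∈ sierpinskiDimers d (n + 1), F H =
      ∑ h ∈ Fintype.piFinset (fun _ : Fin (d + 1) => sierpinskiDimers d n) with
        ∀ i j, i ≠ j → ¬ (j ∈ coveredCorners d n (h i) ∧ i ∈ coveredCorners d n (h j)),
        F (sierpinskiGlue d n h) := by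
  symm
  refine Finset.sum_bij (fun h _ => sierpinskiGlue d n h) ?_ ?_ ?_ (fun _ _ => rfl)
  · intro h hh
    rw [mem_filter, Fintype.mem_piFinset] at hh
    exact sierpinskiGlue_mem hh.1 hh.2
  · intro h hh h' hh' e
    rw [mem_filter, Fintype.mem_piFinset] at hh hh'
    exact sierpinskiGlue_injOn (fun i => (mem_sierpinskiDimers.1 (hh.1 i)).1)
      (fun i => (mem_sierpinskiDimers.1 (hh'.1 i)).1) e
  · intro H hH
    obtain ⟨h, h1, h2, h3⟩ := exists_sierpinskiGlue hH
    exact ⟨h, by rw [mem_filter, Fintype.mem_piFinset]; exact ⟨h1, h2⟩, h3⟩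

end Glue

/-- The matchings of the gasket are the dimer configurations of the ambient lattice graph. -/
lemma numDimerMonomers_sierpinskiGasket (d n : ℕ) :
    numDimerMonomers (sierpinskiGasket d n) = #(sierpinskiDimers d n) := by
  rw [numDimerMonomers, ← Fintype.card_coe, ← Nat.card_eq_fintype_card]
  refine Nat.card_eq_of_bijective (fun M =>
    ⟨M.1.spanningCoe.map (Function.Embedding.subtype _), mem_sierpinskiDimers.2 ⟨?_, ?_⟩⟩) ⟨?_, ?_⟩
  · intro a b hab
    obtain ⟨x, y, hxy, rfl, rfl⟩ := (SimpleGraph.map_adj _ _ _ _).1 hab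
    exact M.1.adj_sub hxy
  · intro a b c hab hac
    obtain ⟨x, y, hxy, rfl, rfl⟩ := (SimpleGraph.map_adj _ _ _ _).1 hab
    obtain ⟨x', y', hxy', h, rfl⟩ := (SimpleGraph.map_adj _ _ _ _).1 hac
    obtain rfl := Subtype.ext h
    exact congrArg _ (M.2.eq_of_adj_left hxy hxy')
  · rintro ⟨M, hM⟩ ⟨M', hM'⟩ e
    have e' := SimpleGraph.map_injective _ (congrArg Subtype.val e)
    have hadj : ∀ x y, M.Adj x y ↔ M'.Adj x y := fun x y => by
      rw [← SimpleGraph.Subgraph.spanningCoe_adj, e', SimpleGraph.Subgraph.spanningCoe_adj]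
    -- The vertex set of a matching is its support, so the edges determine the subgraph.
    refine Subtype.ext (SimpleGraph.Subgraph.ext ?_ ?_)
    · ext x
      rw [← hM.support_eq_verts, ← hM'.support_eq_verts, SimpleGraph.Subgraph.mem_support,
        SimpleGraph.Subgraph.mem_support]
      simp only [hadj]
    · ext x y
      exact hadj x y
  · rintro ⟨H, hH⟩
    have hH' := mem_sierpinskiDimers.1 hH
    refine ⟨⟨⟨{x | x.1 ∈ H.support}, fun x y => H.Adj x y, fun h => hH'.1 h,
      fun h => ⟨_, h⟩, ⟨fun x y h => H.symm.symm _ _ h⟩⟩, ?_⟩, ?_⟩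
    · rintro x ⟨y, hy⟩
      exact ⟨⟨y, mem_sierpinskiVerts_of_adj (hH'.1 hy).symm⟩, hy,
        fun z hz => Subtype.ext (hH'.2 hz hy)⟩
    · refine Subtype.ext ?_
      ext a b
      simp only [SimpleGraph.map_adj]
      constructor
      · rintro ⟨x, y, h, rfl, rfl⟩
        exact h
      · intro h
        exact ⟨⟨a, mem_sierpinskiVerts_of_adj (hH'.1 h)⟩,
          ⟨b, mem_sierpinskiVerts_of_adj (hH'.1 h).symm⟩, h, rfl, rfl⟩

/-! ### Counting vertices. -/

/-- The vertices of stage `n` other than the corners. -/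
def sierpinskiInterior (d n : ℕ) : Finset (Fin (d + 1) → ℕ) :=
  sierpinskiVerts d n \ univ.image (sierpinskiCorner d n)

lemma sierpinskiCorner_injective (d n : ℕ) : Function.Injective (sierpinskiCorner d n) := by
  intro i j h
  by_contra hij
  exact sierpinskiCorner_ne hij h

lemma card_image_sierpinskiCorner (d n : ℕ) : #(univ.image (sierpinskiCorner d n)) = d + 1 := by
  rw [card_image_of_injective _ (sierpinskiCorner_injective d n), card_univ, Fintype.card_fin]

lemma card_sierpinskiVerts_eq (d n : ℕ) :
    #(sierpinskiVerts d n) = #(sierpinskiInterior d n) + (d + 1) := by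
  have h : univ.image (sierpinskiCorner d n) ⊆ sierpinskiVerts d n := by
    intro x hx
    obtain ⟨i, -, rfl⟩ := Finset.mem_image.1 hx
    exact sierpinskiCorner_mem i
  have := card_sdiff_add_card_eq_card h
  rw [card_image_sierpinskiCorner] at this
  exact this.symm

/-- The vertices of stage `n + 1` are those interior to a copy of stage `n`, and the corners of the
copies. -/
lemma sierpinskiVerts_succ_eq_disjoint (d n : ℕ) :
    sierpinskiVerts d (n + 1) =
      (univ.biUnion fun i => (sierpinskiInterior d n).map (sierpinskiShift d n i)) ∪
        univ.image fun p : Fin (d + 1) × Fin (d + 1) =>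
          sierpinskiCorner d n p.1 + sierpinskiCorner d n p.2 := by
  ext x
  rw [sierpinskiVerts_succ]
  simp only [mem_biUnion, mem_univ, true_and, Finset.mem_map, mem_union, Finset.mem_image,
    sierpinskiInterior, mem_sdiff, sierpinskiShift_apply, Prod.exists]
  constructor
  · rintro ⟨i, y, hy, rfl⟩
    by_cases h : ∃ j, sierpinskiCorner d n j = y
    · obtain ⟨j, rfl⟩ := h
      exact Or.inr ⟨j, i, rfl⟩
    · exact Or.inl ⟨i, y, ⟨hy, h⟩, rfl⟩
  · rintro (⟨i, y, ⟨hy, -⟩, rfl⟩ | ⟨i, j, rfl⟩)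
    · exact ⟨i, y, hy, rfl⟩
    · exact ⟨j, _, sierpinskiCorner_mem i, rfl⟩

lemma card_sierpinskiVerts_four_succ (n : ℕ) :
    #(sierpinskiVerts 4 (n + 1)) + 10 = 5 * #(sierpinskiVerts 4 n) := by
  have hdisj : Disjoint
      (univ.biUnion fun i => (sierpinskiInterior 4 n).map (sierpinskiShift 4 n i))
      (univ.image fun p : Fin 5 × Fin 5 => sierpinskiCorner 4 n p.1 + sierpinskiCorner 4 n p.2) := by
    rw [Finset.disjoint_left]
    simp only [mem_biUnion, mem_univ, true_and, Finset.mem_map, Finset.mem_image,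
      sierpinskiInterior, mem_sdiff, sierpinskiShift_apply, Prod.exists]
    rintro _ ⟨i, y, ⟨hy, hy'⟩, rfl⟩ ⟨j, k, h⟩
    by_cases hik : i = k
    · subst hik
      exact hy' ⟨j, add_right_cancel h⟩
    · exact hy' ⟨k, (eq_sierpinskiCorner_of_shift_eq hik hy h.symm).symm⟩
  have hcorner : #(univ.image fun p : Fin 5 × Fin 5 =>
      sierpinskiCorner 4 n p.1 + sierpinskiCorner 4 n p.2) = 15 := by
    -- Scaling by `2 ^ n` reduces the count to unordered pairs with repetition: 5 outmost corners
    -- and 10 gluing vertices.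
    have h0 : #(univ.image fun p : Fin 5 × Fin 5 =>
      (Pi.single p.1 1 + Pi.single p.2 1 : Fin 5 → ℕ)) = 15 := by decide +kernel
    have hinj : Function.Injective fun x : Fin 5 → ℕ => 2 ^ n • x := fun x y h => by
      funext k
      simpa using congrFun h k
    refine Eq.trans ?_ ((card_image_of_injective _ hinj).trans h0)
    rw [image_image]
    congr 2
    ext p k
    simp [sierpinskiCorner, Pi.single_apply, mul_add]
  rw [sierpinskiVerts_succ_eq_disjoint, card_union_of_disjoint hdisj, hcorner, card_biUnion]
  · simp only [card_map, sum_const, card_univ, Fintype.card_fin, smul_eq_mul,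
      card_sierpinskiVerts_eq]
    ring
  · intro i _ j _ hij
    rw [Function.onFun, Finset.disjoint_left]
    simp only [Finset.mem_map, sierpinskiInterior, mem_sdiff, sierpinskiShift_apply]
    rintro _ ⟨x, ⟨hx, hx'⟩, rfl⟩ ⟨y, -, h⟩
    apply hx'
    rw [eq_sierpinskiCorner_of_shift_eq hij hx h.symm]
    exact mem_image_of_mem _ (mem_univ _)

/-- The number of vertices of the four-dimensional gasket. -/
lemma two_mul_card_sierpinskiVerts_four (n : ℕ) :
    2 * #(sierpinskiVerts 4 n) = 5 * (5 ^ n + 1) := by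
  induction n with
  | zero => decide +kernel
  | succ n ih =>
    have := card_sierpinskiVerts_four_succ n
    rw [pow_succ]
    omega

/-! ### Tournaments. -/

/-- The orientations (tournaments) of the complete graph on `Fin m`, given by the sets of
out-neighbours. -/
def orientations (m : ℕ) : Finset (Fin m → Finset (Fin m)) :=
  univ.filter fun o => (∀ i, i ∉ o i) ∧ ∀ i j, i ≠ j → (j ∈ o i ↔ i ∉ o j)

section Orientations

variable {m : ℕ}

lemma mem_orientations {o : Fin m → Finset (Fin m)} :
    o ∈ orientations m ↔ (∀ i, i ∉ o i) ∧ ∀ i j, i ≠ j → (j ∈ o i ↔ i ∉ o j) := by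
  simp [orientations]

/-- Each unordered pair is oriented independently, so the sum factors over pairs. An orientation is
encoded by the set of pairs `i < j` directed from `i` to `j`, which matches the subsets in
`Finset.prod_add`. -/
lemma sum_orientations_prod {R : Type*} [CommSemiring R] (F : Fin m → Fin m → Bool → R) :
    ∑ o ∈ orientations m, ∏ i, ∏ j ∈ {i}ᶜ, F i j (decide (j ∈ o i)) =
      ∏ i, ∏ j ∈ Ioi i, (F i j true * F j i false + F i j false * F j i true) := by
  have hpairs : ∀ f : Fin m → Fin m → R, ∏ i, ∏ j ∈ Ioi i, f i j =
      ∏ p ∈ (univ : Finset (Fin m × Fin m)) with p.1 < p.2, f p.1 p.2 := fun f => by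
    rw [Finset.prod_filter, Fintype.prod_prod_type]
    refine Finset.prod_congr rfl fun i _ => ?_
    rw [← Finset.prod_filter]
    refine Finset.prod_congr (by ext; simp) fun _ _ => rfl
  rw [hpairs, Finset.prod_add]
  refine Finset.sum_bij' (fun o _ => univ.filter fun p : Fin m × Fin m => p.1 < p.2 ∧ p.2 ∈ o p.1)
    (fun t _ i => univ.filter fun j => (i < j ∧ (i, j) ∈ t) ∨ (j < i ∧ (j, i) ∉ t)) ?_ ?_ ?_ ?_ ?_
  · intro o _
    rw [mem_powerset]
    intro p
    simp only [mem_filter, mem_univ, true_and]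
    exact And.left
  · intro t _
    simp only [mem_orientations, mem_filter, mem_univ, true_and]
    refine ⟨by simp, fun i j hij => ?_⟩
    rcases lt_or_gt_of_ne hij with h | h
    · simp [h, h.not_gt]
    · simp [h, h.not_gt]
  · intro o ho
    rw [mem_orientations] at ho
    funext i
    ext j
    simp only [mem_filter, mem_univ, true_and]
    rcases lt_trichotomy i j with h | h | h
    · simp [h, h.not_gt]
    · subst h
      simpa using ho.1 i
    · simp [h, h.not_gt, ho.2 i j h.ne']
  · intro t ht
    rw [mem_powerset] at ht
    ext ⟨i, j⟩
    simp only [mem_filter, mem_univ, true_and]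
    constructor
    · rintro ⟨h, h' | h'⟩
      · exact h'.2
      · exact absurd h h'.1.not_gt
    · intro h
      have := ht h
      simp only [mem_filter, mem_univ, true_and] at this
      exact ⟨this, Or.inl ⟨this, h⟩⟩
  · intro o ho
    rw [mem_orientations] at ho
    rw [← Finset.prod_prod_Ioi_mul_eq_prod_prod_off_diag
      (fun a b => F b a (decide (a ∈ o b))), hpairs,
      ← Finset.prod_sdiff (s₁ := univ.filter fun p : Fin m × Fin m => p.1 < p.2 ∧ p.2 ∈ o p.1)
        (s₂ := univ.filter fun p : Fin m × Fin m => p.1 < p.2), mul_comm]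
    · congr 1
      · refine Finset.prod_congr rfl fun p hp => ?_
        simp only [mem_filter, mem_univ, true_and] at hp
        have := (ho.2 _ _ hp.1.ne).1 hp.2
        simp [hp.2, this]
      · refine Finset.prod_congr rfl fun p hp => ?_
        simp only [mem_sdiff, mem_filter, mem_univ, true_and] at hp
        have h2 : p.2 ∉ o p.1 := fun h => hp.2 ⟨hp.1, h⟩
        have := (ho.2 _ _ hp.1.ne').2 h2
        simp [h2, this]
    · intro p
      simp only [mem_filter, mem_univ, true_and]
      exact And.left

lemma card_orientations_eq : #(orientations m) = ∏ i : Fin m, 2 ^ #(Ioi i) := by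
  have := sum_orientations_prod (m := m) (fun _ _ _ => (1 : ℕ))
  simpa using this

/-- Every edge contributes exactly one out-neighbour. -/
lemma two_mul_sum_card_of_mem_orientations {o : Fin m → Finset (Fin m)}
    (ho : o ∈ orientations m) : 2 * ∑ i, #(o i) = m * (m - 1) := by
  rw [mem_orientations] at ho
  have h1 : ∀ i, #(o i) = ∑ j, if j ∈ o i then 1 else 0 := fun i => by simp
  have h2 : ∑ i, #(o i) = ∑ i, ∑ j, if i ∈ o j then 1 else 0 := by
    rw [Finset.sum_comm]
    simp
  have h3 : ∀ i : Fin m, ∑ j : Fin m, (if j = i then 0 else 1) = m - 1 := fun i => by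
    simp [Finset.sum_ite, Finset.filter_ne', Finset.card_erase_of_mem]
  rw [two_mul]
  nth_rw 2 [h2]
  simp_rw [h1, ← Finset.sum_add_distrib]
  calc _ = ∑ i : Fin m, ∑ j : Fin m, (if j = i then 0 else 1) := by
        refine Finset.sum_congr rfl fun i _ => Finset.sum_congr rfl fun j _ => ?_
        by_cases hij : j = i
        · subst hij
          simp [ho.1 j]
        · have := ho.2 i j (Ne.symm hij)
          by_cases h : i ∈ o j <;> simp [this, hij, h]
    _ = _ := by simp [h3]

/-- Relabelling an orientation along a permutation. -/
lemma sum_orientations_perm {M : Type*} [AddCommMonoid M] (σ : Equiv.Perm (Fin m))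
    (F : (Fin m → Finset (Fin m)) → M) :
    ∑ o ∈ orientations m, F (fun i => (o (σ.symm i)).map σ.toEmbedding) =
      ∑ o ∈ orientations m, F o := by
  refine Finset.sum_bij' (fun o _ i => (o (σ.symm i)).map σ.toEmbedding)
    (fun o _ i => (o (σ i)).map σ.symm.toEmbedding) ?_ ?_ ?_ ?_ (fun _ _ => rfl)
  · intro o ho
    rw [mem_orientations] at ho ⊢
    simp only [Finset.mem_map_equiv]
    exact ⟨fun i => ho.1 _, fun i j hij => ho.2 _ _ (σ.symm.injective.ne hij)⟩
  · intro o ho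
    rw [mem_orientations] at ho ⊢
    simp only [Finset.mem_map_equiv, Equiv.symm_symm]
    exact ⟨fun i => ho.1 _, fun i j hij => ho.2 _ _ (σ.injective.ne hij)⟩
  · intro o _
    funext i
    ext j
    simp [Finset.mem_map_equiv]
  · intro o _
    funext i
    ext j
    simp [Finset.mem_map_equiv]

/-- Adding to the out-neighbours of `i` the vertex `i` itself when it lies in `S`. -/
def outSet (S : Finset (Fin m)) (o : Fin m → Finset (Fin m)) (i : Fin m) : Finset (Fin m) :=
  if i ∈ S then insert i (o i) else o i

lemma mem_outSet_self {S : Finset (Fin m)} {o : Fin m → Finset (Fin m)} (ho : o ∈ orientations m)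
    {i : Fin m} : i ∈ outSet S o i ↔ i ∈ S := by
  have := (mem_orientations.1 ho).1 i
  by_cases h : i ∈ S <;> simp [outSet, h, this]

lemma mem_outSet_of_ne {S : Finset (Fin m)} {o : Fin m → Finset (Fin m)} {i j : Fin m}
    (h : j ≠ i) : j ∈ outSet S o i ↔ j ∈ o i := by
  by_cases hi : i ∈ S <;> simp [outSet, hi, h]

lemma card_outSet {S : Finset (Fin m)} {o : Fin m → Finset (Fin m)} (ho : o ∈ orientations m)
    {i : Fin m} : #(outSet S o i) = #(o i) + if i ∈ S then 1 else 0 := by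
  have := (mem_orientations.1 ho).1 i
  by_cases hi : i ∈ S <;> simp [outSet, hi, this]

lemma outSet_perm (σ : Equiv.Perm (Fin m)) (S : Finset (Fin m)) (o : Fin m → Finset (Fin m))
    (i : Fin m) : outSet (S.map σ.toEmbedding) (fun i => (o (σ.symm i)).map σ.toEmbedding) i =
      (outSet S o (σ.symm i)).map σ.toEmbedding := by
  ext j
  by_cases h : σ.symm i ∈ S
  · simp [outSet, h, Finset.mem_map_equiv]
  · simp [outSet, h, Finset.mem_map_equiv]

end Orientations

/-! ### Weighted corner sums and their recursion. -/

/-- The weight of a corner: `q` says whether it is covered, `p` whether it may be covered. -/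
def cornerWeight (p q : Bool) : ℕ := bif q then (bif p then 2 else 0) else 1

/-- The number of matchings of stage `n` that cover no corner outside `S`, each of them weighted
by `2` to the number of corners covered. -/
noncomputable def cornerSum (d n : ℕ) (S : Finset (Fin (d + 1))) : ℕ :=
  ∑ H ∈ sierpinskiDimers d n,
    ∏ i, cornerWeight (decide (i ∈ S)) (decide (i ∈ coveredCorners d n H))

/-- The covered weight 2 is chosen for this identity: the left side is 2 if at most one side covers
the shared vertex, and 0 if both do. -/
lemma cornerWeight_add (p q : Bool) :
    cornerWeight true p * cornerWeight false q + cornerWeight false p * cornerWeight true q =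
      2 * bif p && q then 0 else 1 := by
  revert p q
  decide

/-- The recursion for the corner sums, from the expansion of `∏ i < j, (wᵢ + wⱼ)` over
tournaments. -/
theorem card_orientations_mul_cornerSum_succ (d n : ℕ) (S : Finset (Fin (d + 1))) :
    #(orientations (d + 1)) * cornerSum d (n + 1) S =
      ∑ o ∈ orientations (d + 1), ∏ i, cornerSum d n (outSet S o i) := by
  classical
  have hrhs : ∀ o : Fin (d + 1) → Finset (Fin (d + 1)), ∏ i, cornerSum d n (outSet S o i) =
      ∑ h ∈ Fintype.piFinset (fun _ : Fin (d + 1) => sierpinskiDimers d n), ∏ i, ∏ j,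
        cornerWeight (decide (j ∈ outSet S o i)) (decide (j ∈ coveredCorners d n (h i))) :=
    fun o => Finset.prod_univ_sum _ _
  simp_rw [hrhs]
  rw [Finset.sum_comm, cornerSum, sum_sierpinskiDimers_succ, Finset.sum_filter, Finset.mul_sum]
  refine Finset.sum_congr rfl fun h hh => ?_
  have hle : ∀ i, h i ≤ sierpinskiLatticeGraph d n := fun i =>
    (mem_sierpinskiDimers.1 (Fintype.mem_piFinset.1 hh i)).1
  -- Corner `i` of copy `i` is outmost and governed by `S`; its other corners are gluing vertices
  -- governed by the tournament.
  have hsplit : ∀ o ∈ orientations (d + 1), ∏ i, ∏ j,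
      cornerWeight (decide (j ∈ outSet S o i)) (decide (j ∈ coveredCorners d n (h i))) =
      (∏ i, cornerWeight (decide (i ∈ S)) (decide (i ∈ coveredCorners d n (h i)))) *
      ∏ i, ∏ j ∈ {i}ᶜ,
        cornerWeight (decide (j ∈ o i)) (decide (j ∈ coveredCorners d n (h i))) := by
    intro o ho
    rw [← Finset.prod_mul_distrib]
    refine Finset.prod_congr rfl fun i _ => ?_
    rw [Fintype.prod_eq_mul_prod_compl i]
    congr 1
    · simp only [mem_outSet_self ho]
    · refine Finset.prod_congr rfl fun j hj => ?_
      simp only [mem_compl, mem_singleton] at hj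
      simp only [mem_outSet_of_ne hj]
  rw [Finset.sum_congr rfl hsplit, ← Finset.mul_sum, sum_orientations_prod (fun i j b =>
    cornerWeight b (decide (j ∈ coveredCorners d n (h i))))]
  -- Each pair yields a factor 2, and these multiply to the number of tournaments, times the
  -- indicator that its gluing vertex is not covered twice.
  simp only [cornerWeight_add, Finset.prod_mul_distrib, coveredCorners_sierpinskiGlue hle]
  rw [card_orientations_eq]
  simp only [Finset.prod_const]
  split_ifs with hc
  · rw [mul_comm, ← mul_assoc]
    rw [Finset.prod_eq_one (s := univ)
      (f := fun x => ∏ x_1 ∈ Ioi x, bif _ && _ then 0 else 1), mul_one]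
    intro i _
    refine Finset.prod_eq_one fun j hj => ?_
    have := hc i j (mem_Ioi.1 hj).ne
    by_cases h1 : j ∈ coveredCorners d n (h i) <;> simp_all
  · push Not at hc
    obtain ⟨i, j, hij, h1, h2⟩ := hc
    rw [mul_zero]
    symm
    apply mul_eq_zero_of_right
    apply mul_eq_zero_of_right
    rcases lt_or_gt_of_ne hij with hlt | hlt
    · exact Finset.prod_eq_zero (mem_univ i)
        (Finset.prod_eq_zero (mem_Ioi.2 hlt) (by simp [h1, h2]))
    · exact Finset.prod_eq_zero (mem_univ j)
        (Finset.prod_eq_zero (mem_Ioi.2 hlt) (by simp [h1, h2]))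

/-! ### Dependence on the number of corners only. -/

section Symmetry

lemma exists_map_perm_eq {α : Type*} [Fintype α] [DecidableEq α] {S T : Finset α}
    (h : #S = #T) : ∃ σ : Equiv.Perm α, S.map σ.toEmbedding = T := by
  refine ⟨(Finset.equivOfCardEq h).extendSubtype, ?_⟩
  refine Finset.eq_of_subset_of_card_le ?_ (by simp [h])
  intro x hx
  obtain ⟨y, hy, rfl⟩ := Finset.mem_map.1 hx
  exact Equiv.extendSubtype_mem _ y hy

/-- If the corner sums of stage `n` depend on the number of corners only, then so do those of
stage `n + 1`. -/
lemma cornerSum_succ_map_perm {d n : ℕ} {C : ℕ → ℕ} (hC : ∀ S, cornerSum d n S = C #S)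
    (σ : Equiv.Perm (Fin (d + 1))) (S : Finset (Fin (d + 1))) :
    cornerSum d (n + 1) (S.map σ.toEmbedding) = cornerSum d (n + 1) S := by
  have hpos : 0 < #(orientations (d + 1)) := by
    rw [card_orientations_eq]
    positivity
  apply Nat.eq_of_mul_eq_mul_left hpos
  rw [card_orientations_mul_cornerSum_succ, card_orientations_mul_cornerSum_succ,
    ← sum_orientations_perm σ]
  refine Finset.sum_congr rfl fun o _ => ?_
  simp only [outSet_perm, hC, card_map]
  exact Equiv.prod_comp σ.symm fun i => C #(outSet S o i)

end Symmetry

/-! ### Exact corner sums for stages 0 to 4. -/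

section Stages

/-- The sum of a function over the two truth values. -/
def boolSum (F : Bool → ℕ) : ℕ := F true + F false

lemma boolSum_eq (F : Bool → ℕ) : boolSum F = ∑ b, F b := by
  rw [boolSum, Fintype.sum_bool]

/-- The sum of `∏ i, f i (score of i)` over the tournaments on five vertices, one vertex after the
other. -/
def tournamentSum (f : Fin 5 → ℕ → ℕ) : ℕ :=
  -- The letters orient the edges 01, 02, 03, 04; 12, 13, 14; 23, 24; 34, with `true` pointing to
  -- the larger vertex. Each factor stands outside the sums that do not affect it, which saves
  -- multiplications.
  boolSum fun a => boolSum fun b => boolSum fun c => boolSum fun e =>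
    f 0 (a.toNat + b.toNat + c.toNat + e.toNat) *
  boolSum fun p => boolSum fun q => boolSum fun r =>
    f 1 ((!a).toNat + p.toNat + q.toNat + r.toNat) *
  boolSum fun s => boolSum fun t =>
    f 2 ((!b).toNat + (!p).toNat + s.toNat + t.toNat) *
  boolSum fun u =>
    f 3 ((!c).toNat + (!q).toNat + (!s).toNat + u.toNat) *
    f 4 ((!e).toNat + (!r).toNat + (!t).toNat + (!u).toNat)

/-- The orientation of the complete graph on five vertices with given directions of the edges. -/
def orientationOfBools (a b c e p q r s t u : Bool) (i : Fin 5) : Finset (Fin 5) :=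
  univ.filter fun j => ![![false, a, b, c, e], ![!a, false, p, q, r], ![!b, !p, false, s, t],
    ![!c, !q, !s, false, u], ![!e, !r, !t, !u, false]] i j = true

lemma card_orientationOfBools (a b c e p q r s t u : Bool) (i : Fin 5) :
    #(orientationOfBools a b c e p q r s t u i) =
      ![a.toNat + b.toNat + c.toNat + e.toNat, (!a).toNat + p.toNat + q.toNat + r.toNat,
        (!b).toNat + (!p).toNat + s.toNat + t.toNat,
        (!c).toNat + (!q).toNat + (!s).toNat + u.toNat,
        (!e).toNat + (!r).toNat + (!t).toNat + (!u).toNat] i := by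
  have hbool : ∀ b : Bool, (if b = true then 1 else 0) = b.toNat := by decide
  rw [orientationOfBools, Finset.card_filter, Fin.sum_univ_five]
  simp only [hbool]
  fin_cases i <;> simp

lemma sum_bool_prod
    (F : Bool → Bool → Bool → Bool → Bool → Bool → Bool → Bool → Bool → Bool → ℕ) :
    ∑ x : Bool × Bool × Bool × Bool × Bool × Bool × Bool × Bool × Bool × Bool,
        F x.1 x.2.1 x.2.2.1 x.2.2.2.1 x.2.2.2.2.1 x.2.2.2.2.2.1
          x.2.2.2.2.2.2.1 x.2.2.2.2.2.2.2.1 x.2.2.2.2.2.2.2.2.1 x.2.2.2.2.2.2.2.2.2 =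
      ∑ a, ∑ b, ∑ c, ∑ e, ∑ p, ∑ q, ∑ r, ∑ s, ∑ t, ∑ u, F a b c e p q r s t u := by
  simp only [Fintype.sum_prod_type]

lemma orientationOfBools_decide {o : Fin 5 → Finset (Fin 5)} (ho : o ∈ orientations 5) :
    orientationOfBools (decide (1 ∈ o 0)) (decide (2 ∈ o 0)) (decide (3 ∈ o 0))
      (decide (4 ∈ o 0)) (decide (2 ∈ o 1)) (decide (3 ∈ o 1)) (decide (4 ∈ o 1))
      (decide (3 ∈ o 2)) (decide (4 ∈ o 2)) (decide (4 ∈ o 3)) = o := by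
  rw [mem_orientations] at ho
  obtain ⟨B, hB⟩ : ∃ B : Fin 5 → Fin 5 → Bool, ∀ i j, decide (j ∈ o i) = B i j :=
    ⟨_, fun _ _ => rfl⟩
  have h1 : ∀ i, B i i = false := fun i => by simp [← hB, ho.1 i]
  have h2 : ∀ i j, i ≠ j → B i j = !B j i := fun i j hij => by simp [← hB, ho.2 i j hij]
  simp only [hB]
  funext i
  ext j
  rw [← decide_eq_true_iff (p := j ∈ o i), hB]
  simp only [orientationOfBools, mem_filter, mem_univ, true_and]
  apply iff_of_eq
  congr 1
  -- Entries above the diagonal agree by definition, diagonal ones by `h1`, lower ones by `h2`.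
  fin_cases i <;> fin_cases j <;>
    first | rfl | exact (h1 _).symm | exact (h2 _ _ (by decide)).symm

lemma sum_orientations_five (f : Fin 5 → ℕ → ℕ) :
    ∑ o ∈ orientations 5, ∏ i, f i #(o i) = tournamentSum f := by
  have hsum : tournamentSum f =
      ∑ x : Bool × Bool × Bool × Bool × Bool × Bool × Bool × Bool × Bool × Bool,
        ∏ i, f i #(orientationOfBools x.1 x.2.1 x.2.2.1 x.2.2.2.1 x.2.2.2.2.1 x.2.2.2.2.2.1
          x.2.2.2.2.2.2.1 x.2.2.2.2.2.2.2.1 x.2.2.2.2.2.2.2.2.1 x.2.2.2.2.2.2.2.2.2 i) := by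
    rw [sum_bool_prod (fun a b c e p q r s t u => ∏ i, f i #(orientationOfBools a b c e p q r s t u i))]
    simp only [tournamentSum, boolSum_eq, Finset.mul_sum]
    iterate 10 refine Finset.sum_congr rfl fun _ _ => ?_
    simp only [Fin.prod_univ_five, card_orientationOfBools, Matrix.cons_val]
    ring
  rw [hsum]
  refine Finset.sum_bij'
    (fun o _ => (decide (1 ∈ o 0), decide (2 ∈ o 0), decide (3 ∈ o 0), decide (4 ∈ o 0),
      decide (2 ∈ o 1), decide (3 ∈ o 1), decide (4 ∈ o 1), decide (3 ∈ o 2), decide (4 ∈ o 2),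
      decide (4 ∈ o 3)))
    (fun x _ => orientationOfBools x.1 x.2.1 x.2.2.1 x.2.2.2.1 x.2.2.2.2.1 x.2.2.2.2.2.1
      x.2.2.2.2.2.2.1 x.2.2.2.2.2.2.2.1 x.2.2.2.2.2.2.2.2.1 x.2.2.2.2.2.2.2.2.2) ?_ ?_
    (fun o ho => orientationOfBools_decide ho) ?_ ?_
  · exact fun _ _ => mem_univ _
  · rintro ⟨a, b, c, e, p, q, r, s, t, u⟩ _
    rw [mem_orientations]
    simp only [orientationOfBools, mem_filter, mem_univ, true_and, Fin.forall_fin_succ]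
    simp
  · rintro ⟨a, b, c, e, p, q, r, s, t, u⟩ _
    simp [orientationOfBools]
  · intro o ho
    exact Finset.prod_congr rfl fun i _ => congrArg _ (congrArg _
      (congrFun (orientationOfBools_decide ho).symm i))

/-- One step of the computation of the corner sums. -/
lemma cornerSum_succ_eq {n : ℕ} {C C' : ℕ → ℕ} (hC : ∀ S, cornerSum 4 n S = C #S)
    (hC' : ∀ k < 6, tournamentSum (fun i t => C (t + if i.val < k then 1 else 0)) = 1024 * C' k)
    (S : Finset (Fin 5)) : cornerSum 4 (n + 1) S = C' #S := by
  have hS : #S ≤ 5 := by simpa using card_le_univ S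
  -- By symmetry it suffices to treat the initial segment of the same size.
  have hcard : #(univ.filter fun i : Fin 5 => i.val < #S) = #S := by
    generalize #S = k at hS
    interval_cases k <;> rfl
  obtain ⟨σ, hσ⟩ := exists_map_perm_eq hcard
  rw [← hσ, cornerSum_succ_map_perm hC, card_map, hcard]
  have h := card_orientations_mul_cornerSum_succ 4 n (univ.filter fun i : Fin 5 => i.val < #S)
  have h1024 : #(orientations 5) = 1024 := by
    rw [card_orientations_eq]
    rfl
  rw [h1024] at h
  apply Nat.eq_of_mul_eq_mul_left (by norm_num : 0 < 1024)
  rw [h, ← hC' #S (by omega), ← sum_orientations_five]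
  refine Finset.sum_congr rfl fun o ho => Finset.prod_congr rfl fun i _ => ?_
  rw [hC, card_outSet ho]
  simp

/-- The corner sums of stage `0`, by the number of corners. -/
def cornerValuesZero (k : ℕ) : ℕ :=
  [1,
    1,
    5,
    13,
    73,
    281].getD k 0

/-- The corner sums of stage `1`, by the number of corners. -/
def cornerValuesOne (k : ℕ) : ℕ :=
  [2460,
    8796,
    31092,
    108164,
    369756,
    1235068].getD k 0

/-- The corner sums of stage `2`, by the number of corners. -/
def cornerValuesTwo (k : ℕ) : ℕ :=
  [27951923701499685610752,
    97137937217942898612480,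
    337548083158832776968960,
    1172875560061458952047360,
    4075094409995518979050752,
    14157702625933884410083584].getD k 0

/-- The corner sums of stage `3`, by the number of corners. -/
def cornerValuesThree (k : ℕ) : ℕ :=
  [4381290355170456323411540736988672115345849305231157688784584133989733549574862862597653855841117080778234763673600000,
    15223632457900844055112519127073747823260928185505600205911198860789775136029124416370065161282807586064405828626022400,
    52897426588882460184109762288094766875265265013669437210524615367144055732652453279938376113897531171568133793749401600,
    183802239315129254779608826507016056851399079672103584767015214616101822900651528684757634391933572554335277188990894080,
    638656080533414264291437706131666999425915152616362518739737250420322529348642193743404099646693303042347723640453201920,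
    2219132858330245663365777377467059928621081071321117298408116103545104415594551358743822327797823280694693231060844544000].getD k 0

/-- The corner sums of stage `4`, by the number of corners. -/
def cornerValuesFour (k : ℕ) : ℕ :=
  [414164357481597919058687457763094288659442977860921646607365385988198488998433463726312662130430232357868334909596743842600630995823951109166199456322754666301367873476052943460984943104688120843272275776295835290859050277301002247969889774202237262833692072405683724261005617470830985904594845785635250126041523015578681627205816493220405471344150186186607409432172692935777595981480540814748064871587479090018513561566903784904946606104926696489275164026465794433339293606056504249104719974115062296390338417643129776576558073997497114426556104273018568519277777613218111375412297728000000000,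
    1439093378611135993378303676188605930786880404186343151394453177256624251736129710760819591905002390266405024885468965589967246083943559457217808954917783438368230356857098559990674441986333299080554532094489279893051181941268748236439991678956695378677387385803033097720642232632105418660244965198369179179204071297963122246815741020488561123971348805639181539201932735210589702522158856680606168179022002606444611871268345351487102216351955117327564482943369262986952027328667762201464014253288420830362484229786852107152201696610222649787045750164321131646967682446920136634359328276480000000,
    5000405551446884884434412476466723326976509414584812773242983789573625495487276309510634026653017613426633554042215098023932827390093056449617361884576765657117400336402606554711006662389700213892110548293523414655316802237101804521094258407959931237295822516143840448091474646910422381130282689662882159989753752587521914703124182425503963863307303972604440457443597215311785535006301146744274060250883844534500390945068932894953987789153491163686290774414726954240186205583952445851939928270252627160216284749915164290534424855982462657993598986331826703169674365939146214079721457582080000000,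
    17374866739413499309867515654509980356693468411003591696041576278475207893334810330063934629925914745422803682818364315129252285717328392439818680969321090522453138154677922126723031295866829241164900534587412461431708951310571020092753725346345568324903099156266831282880466176183449854460676718071434998761393167545956876690248790143623230890163498833318487637107003536572258313466870963038964152142018910754397528730190821394569484419770439351730650332104444379190020394914944723233206001670138152852819695334837469630131925066513122915884851949914760294227909602691713437188671332679680000000,
    60372302027587685077905467694101834898289490618506114918699702671538508418988905256521816331545933627505213204432830193669260076877883370747482841040667353196571666596481035658348240681013001391001502505619008217950057149862766634957326225235576497548244183733673311964348220575016956323184605201143724639466475179741179810289144902506441461175117049542198070149613836010781312392433182512064811936603795584216637047840422653221715354323452857208276216440412318419238461479640227818932316558790049511716282870247896389143514664069072974854236875872851515550251504419381605927411949217251328000000,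
    209775125575052402692777203055790298780271081292291637182638250179397074538034022611119294341254757994317099084848738295931298012845895520309824342659981891713917976274144646986031026373711660499058160832472572919794460204805625792079861711286599763307087979332868084062229601661585786005711602011458740252064573002712522636984841819185131686171901274286543442280226718778149246904265015308940438506267649496790189000443667830613216631631511771708591481103246735625865281784803389462491781956657680106603504356659030084537504382257197363268685608101230970424999521011069589023993155516419276800000].getD k 0

/-- The matching of stage `0` given by an involution of the corners. -/
def dimersOfPerm (d : ℕ) (σ : Equiv.Perm (Fin (d + 1))) : SimpleGraph (Fin (d + 1) → ℕ) :=
  SimpleGraph.fromRel fun x y => ∃ i, x = sierpinskiCorner d 0 i ∧ y = sierpinskiCorner d 0 (σ i)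

lemma dimersOfPerm_adj {d : ℕ} {σ : Equiv.Perm (Fin (d + 1))} (hσ : ∀ i, σ (σ i) = i)
    {x y : Fin (d + 1) → ℕ} : (dimersOfPerm d σ).Adj x y ↔
      ∃ i, σ i ≠ i ∧ x = sierpinskiCorner d 0 i ∧ y = sierpinskiCorner d 0 (σ i) := by
  rw [dimersOfPerm, SimpleGraph.fromRel_adj]
  constructor
  · rintro ⟨hne, ⟨i, rfl, rfl⟩ | ⟨i, rfl, rfl⟩⟩
    · exact ⟨i, fun h => hne (by rw [h]), rfl, rfl⟩
    · exact ⟨σ i, fun h => hne (by rw [hσ] at h; rw [← h]), rfl, by rw [hσ]⟩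
  · rintro ⟨i, hi, rfl, rfl⟩
    exact ⟨sierpinskiCorner_ne hi.symm, Or.inl ⟨i, rfl, rfl⟩⟩

lemma sierpinskiLatticeGraph_zero_adj {d : ℕ} {x y : Fin (d + 1) → ℕ} :
    (sierpinskiLatticeGraph d 0).Adj x y ↔
      ∃ i j, i ≠ j ∧ x = sierpinskiCorner d 0 i ∧ y = sierpinskiCorner d 0 j := by
  constructor
  · rintro ⟨-, i, j, hij, rfl, rfl⟩
    exact ⟨i, j, hij, rfl, rfl⟩
  · rintro ⟨i, j, hij, rfl, rfl⟩
    exact ⟨sierpinskiCorner_ne hij, i, j, hij, rfl, rfl⟩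

lemma mem_coveredCorners_dimersOfPerm {d : ℕ} {σ : Equiv.Perm (Fin (d + 1))}
    (hσ : ∀ i, σ (σ i) = i) {i : Fin (d + 1)} :
    i ∈ coveredCorners d 0 (dimersOfPerm d σ) ↔ σ i ≠ i := by
  simp only [mem_coveredCorners, dimersOfPerm_adj hσ]
  constructor
  · rintro ⟨y, j, hj, h, -⟩
    rwa [sierpinskiCorner_injective d 0 h]
  · exact fun h => ⟨_, i, h, rfl, rfl⟩

lemma dimersOfPerm_mem {d : ℕ} {σ : Equiv.Perm (Fin (d + 1))} (hσ : ∀ i, σ (σ i) = i) :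
    dimersOfPerm d σ ∈ sierpinskiDimers d 0 := by
  rw [mem_sierpinskiDimers]
  refine ⟨fun x y hxy => ?_, fun x y z hxy hxz => ?_⟩
  · obtain ⟨i, hi, h⟩ := (dimersOfPerm_adj hσ).1 hxy
    exact sierpinskiLatticeGraph_zero_adj.2 ⟨i, σ i, hi.symm, h⟩
  · obtain ⟨i, hi, rfl, rfl⟩ := (dimersOfPerm_adj hσ).1 hxy
    obtain ⟨j, hj, h, rfl⟩ := (dimersOfPerm_adj hσ).1 hxz
    rw [sierpinskiCorner_injective d 0 h]

/-- All vertices of stage 0 are corners; send each to its partner, or to itself if uncovered. -/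
lemma exists_dimersOfPerm {d : ℕ} {H : SimpleGraph (Fin (d + 1) → ℕ)}
    (hH : H ∈ sierpinskiDimers d 0) :
    ∃ σ : Equiv.Perm (Fin (d + 1)), (∀ i, σ (σ i) = i) ∧ dimersOfPerm d σ = H := by
  classical
  rw [mem_sierpinskiDimers] at hH
  have hex : ∀ i, ∃ k, (∃ j, H.Adj (sierpinskiCorner d 0 i) (sierpinskiCorner d 0 j)) ∧
      H.Adj (sierpinskiCorner d 0 i) (sierpinskiCorner d 0 k) ∨
      (¬ ∃ j, H.Adj (sierpinskiCorner d 0 i) (sierpinskiCorner d 0 j)) ∧ k = i := by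
    intro i
    by_cases h : ∃ j, H.Adj (sierpinskiCorner d 0 i) (sierpinskiCorner d 0 j)
    · exact ⟨h.choose, Or.inl ⟨h, h.choose_spec⟩⟩
    · exact ⟨i, Or.inr ⟨h, rfl⟩⟩
  choose f hf using hex
  have hadj : ∀ {i j}, H.Adj (sierpinskiCorner d 0 i) (sierpinskiCorner d 0 j) → f i = j := by
    intro i j hij
    rcases hf i with ⟨-, h⟩ | ⟨h, -⟩
    · exact sierpinskiCorner_injective d 0 (hH.2 h hij)
    · exact absurd ⟨j, hij⟩ h
  have hinv : Function.Involutive f := by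
    intro i
    rcases hf i with ⟨-, h⟩ | ⟨-, h⟩
    · exact hadj h.symm
    · rw [h, h]
  refine ⟨hinv.toPerm f, hinv, ?_⟩
  ext x y
  rw [dimersOfPerm_adj (σ := hinv.toPerm f) hinv]
  constructor
  · rintro ⟨i, hi, rfl, rfl⟩
    rcases hf i with ⟨-, h⟩ | ⟨-, h⟩
    · exact h
    · exact absurd h hi
  · intro hxy
    obtain ⟨i, j, hij, rfl, rfl⟩ := sierpinskiLatticeGraph_zero_adj.1 (hH.1 hxy)
    have : f i = j := hadj hxy
    exact ⟨i, fun h => hij (h.symm.trans this), rfl, congrArg _ this.symm⟩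

/-- The corner sums of the complete graph, as sums over involutions. -/
lemma cornerSum_zero_eq (d : ℕ) (S : Finset (Fin (d + 1))) :
    cornerSum d 0 S = ∑ σ : Equiv.Perm (Fin (d + 1)) with ∀ i, σ (σ i) = i,
      ∏ i, cornerWeight (decide (i ∈ S)) (decide (σ i ≠ i)) := by
  symm
  refine Finset.sum_bij (fun σ _ => dimersOfPerm d σ) ?_ ?_ ?_ ?_
  · intro σ hσ
    exact dimersOfPerm_mem (Finset.mem_filter.1 hσ).2
  · intro σ hσ τ hτ h
    have hσ' := (Finset.mem_filter.1 hσ).2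
    have hτ' := (Finset.mem_filter.1 hτ).2
    ext i
    congr 1
    have hcov : σ i ≠ i ↔ τ i ≠ i := by
      rw [← mem_coveredCorners_dimersOfPerm hσ', ← mem_coveredCorners_dimersOfPerm hτ', h]
    by_cases hi : σ i = i
    · rw [hi, not_not.1 (fun h' => hcov.2 h' hi)]
    · have h1 : (dimersOfPerm d σ).Adj (sierpinskiCorner d 0 i) (sierpinskiCorner d 0 (σ i)) :=
        (dimersOfPerm_adj hσ').2 ⟨i, hi, rfl, rfl⟩
      have h2 : (dimersOfPerm d σ).Adj (sierpinskiCorner d 0 i) (sierpinskiCorner d 0 (τ i)) := by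
        have h : dimersOfPerm d σ = dimersOfPerm d τ := h
        rw [h]
        exact (dimersOfPerm_adj hτ').2 ⟨i, hcov.1 hi, rfl, rfl⟩
      exact sierpinskiCorner_injective d 0
        ((mem_sierpinskiDimers.1 (dimersOfPerm_mem hσ')).2 h1 h2)
  · intro H hH
    obtain ⟨σ, hσ, rfl⟩ := exists_dimersOfPerm hH
    exact ⟨σ, Finset.mem_filter.2 ⟨mem_univ _, hσ⟩, rfl⟩
  · intro σ hσ
    simp only [mem_coveredCorners_dimersOfPerm (Finset.mem_filter.1 hσ).2]

lemma cornerSum_zero (S : Finset (Fin 5)) : cornerSum 4 0 S = cornerValuesZero #S := by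
  rw [cornerSum_zero_eq]
  revert S
  decide +kernel

lemma cornerSum_one (S : Finset (Fin 5)) : cornerSum 4 1 S = cornerValuesOne #S :=
  cornerSum_succ_eq cornerSum_zero (by decide +kernel) S

lemma cornerSum_two (S : Finset (Fin 5)) : cornerSum 4 2 S = cornerValuesTwo #S :=
  cornerSum_succ_eq cornerSum_one (by decide +kernel) S

lemma cornerSum_three (S : Finset (Fin 5)) : cornerSum 4 3 S = cornerValuesThree #S :=
  cornerSum_succ_eq cornerSum_two (by decide +kernel) S

lemma cornerSum_four (S : Finset (Fin 5)) : cornerSum 4 4 S = cornerValuesFour #S :=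
  cornerSum_succ_eq cornerSum_three (by decide +kernel) S

end Stages

open Filter Topology

/-! ### Bounds on ratios of corner sums. -/

section Ratios

/-- All the ratios of corner sums of stage `n` for sets differing by one corner lie in `[m, M]`. -/
structure CornerRatioBounds (d n : ℕ) (m M : ℝ) : Prop where
  pos : 0 < cornerSum d n ∅
  lower : ∀ S i, i ∉ S → m * cornerSum d n S ≤ cornerSum d n (insert i S)
  upper : ∀ S i, i ∉ S → (cornerSum d n (insert i S) : ℝ) ≤ M * cornerSum d n S

variable {d n : ℕ} {m M : ℝ}

lemma CornerRatioBounds.pow_mul_le (h : CornerRatioBounds d n m M) (hm : 0 ≤ m)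
    (S : Finset (Fin (d + 1))) : m ^ #S * cornerSum d n ∅ ≤ cornerSum d n S := by
  induction S using Finset.induction_on with
  | empty => simp
  | insert i S hi ih =>
    rw [card_insert_of_notMem hi, pow_succ', mul_assoc]
    exact (mul_le_mul_of_nonneg_left ih hm).trans (h.lower S i hi)

lemma CornerRatioBounds.le_pow_mul (h : CornerRatioBounds d n m M) (hM : 0 ≤ M)
    (S : Finset (Fin (d + 1))) : cornerSum d n S ≤ M ^ #S * cornerSum d n ∅ := by
  induction S using Finset.induction_on with
  | empty => simp
  | insert i S hi ih =>
    rw [card_insert_of_notMem hi, pow_succ', mul_assoc]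
    exact (h.upper S i hi).trans (mul_le_mul_of_nonneg_left ih hM)

/-- Isolates the factor of copy `i`, the only one affected by whether `i` lies in `S`. -/
lemma prod_cornerSum_outSet_insert (S : Finset (Fin (d + 1))) (i : Fin (d + 1))
    (o : Fin (d + 1) → Finset (Fin (d + 1))) :
    ∏ r, cornerSum d n (outSet (insert i S) o r) =
      cornerSum d n (insert i (o i)) * ∏ r ∈ {i}ᶜ, cornerSum d n (outSet S o r) := by
  rw [Fintype.prod_eq_mul_prod_compl i]
  congr 1
  · simp [outSet]
  · refine Finset.prod_congr rfl fun r hr => ?_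
    simp only [mem_compl, mem_singleton] at hr
    simp [outSet, hr]

lemma prod_cornerSum_outSet {S : Finset (Fin (d + 1))} {i : Fin (d + 1)} (hi : i ∉ S)
    (o : Fin (d + 1) → Finset (Fin (d + 1))) :
    ∏ r, cornerSum d n (outSet S o r) =
      cornerSum d n (o i) * ∏ r ∈ {i}ᶜ, cornerSum d n (outSet S o r) := by
  rw [Fintype.prod_eq_mul_prod_compl i]
  simp [outSet, hi]

lemma card_orientations_pos (k : ℕ) : (0 : ℝ) < #(orientations k) := by
  rw [card_orientations_eq]
  positivity

lemma card_orientations_mul_cornerSum_succ_real (d n : ℕ) (S : Finset (Fin (d + 1))) :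
    (#(orientations (d + 1)) : ℝ) * cornerSum d (n + 1) S =
      ∑ o ∈ orientations (d + 1), ∏ i, (cornerSum d n (outSet S o i) : ℝ) := by
  exact_mod_cast card_orientations_mul_cornerSum_succ d n S

lemma sum_card_outSet_empty {o : Fin (d + 1) → Finset (Fin (d + 1))}
    (ho : o ∈ orientations (d + 1)) : ∑ i, #(outSet ∅ o i) = (d + 1) * d / 2 := by
  have := two_mul_sum_card_of_mem_orientations ho
  simp only [outSet, notMem_empty, if_false, add_tsub_cancel_right] at this ⊢
  omega

/-- The new sum is a mean over tournaments of products of old sums; the set sizes in each product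
add up to the number of edges, whence the exponent of `m`. -/
lemma CornerRatioBounds.pow_le_succ (h : CornerRatioBounds d n m M) (hm : 0 ≤ m) :
    m ^ ((d + 1) * d / 2) * (cornerSum d n ∅ : ℝ) ^ (d + 1) ≤ cornerSum d (n + 1) ∅ := by
  refine le_of_mul_le_mul_left ?_ (card_orientations_pos (d + 1))
  rw [card_orientations_mul_cornerSum_succ_real, ← nsmul_eq_mul]
  refine Finset.card_nsmul_le_sum _ _ _ fun o ho => ?_
  calc _ = ∏ i, m ^ #(outSet ∅ o i) * (cornerSum d n ∅ : ℝ) := by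
        rw [Finset.prod_mul_distrib, Finset.prod_pow_eq_pow_sum, sum_card_outSet_empty ho]
        simp
    _ ≤ _ := Finset.prod_le_prod (fun _ _ => by positivity) fun i _ => h.pow_mul_le hm _

lemma CornerRatioBounds.succ_le_pow (h : CornerRatioBounds d n m M) (hM : 0 ≤ M) :
    (cornerSum d (n + 1) ∅ : ℝ) ≤ M ^ ((d + 1) * d / 2) * (cornerSum d n ∅ : ℝ) ^ (d + 1) := by
  refine le_of_mul_le_mul_left ?_ (card_orientations_pos (d + 1))
  rw [card_orientations_mul_cornerSum_succ_real, ← nsmul_eq_mul]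
  refine Finset.sum_le_card_nsmul _ _ _ fun o ho => ?_
  calc _ ≤ ∏ i, M ^ #(outSet ∅ o i) * (cornerSum d n ∅ : ℝ) :=
        Finset.prod_le_prod (fun _ _ => by positivity) fun i _ => h.le_pow_mul hM _
    _ = _ := by
        rw [Finset.prod_mul_distrib, Finset.prod_pow_eq_pow_sum, sum_card_outSet_empty ho]
        simp

/-- Bounds on the ratios persist at later stages, since the new ratios are weighted means of the
old ones. -/
theorem CornerRatioBounds.succ (h : CornerRatioBounds d n m M) (hm : 0 < m) :
    CornerRatioBounds d (n + 1) m M where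
  pos := by
    have hp : (0 : ℝ) < cornerSum d n ∅ := by exact_mod_cast h.pos
    have : (0 : ℝ) < cornerSum d (n + 1) ∅ := lt_of_lt_of_le (by positivity) (h.pow_le_succ hm.le)
    exact_mod_cast this
  lower S i hi := by
    refine le_of_mul_le_mul_left ?_ (card_orientations_pos (d + 1))
    rw [mul_left_comm, card_orientations_mul_cornerSum_succ_real,
      card_orientations_mul_cornerSum_succ_real, Finset.mul_sum]
    -- The comparison holds for each tournament separately, using `i ∉ o i`.
    refine Finset.sum_le_sum fun o ho => ?_
    rw [← Nat.cast_prod, ← Nat.cast_prod, prod_cornerSum_outSet hi,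
      prod_cornerSum_outSet_insert S i, Nat.cast_mul, Nat.cast_mul, ← mul_assoc]
    exact mul_le_mul_of_nonneg_right (h.lower _ i ((mem_orientations.1 ho).1 i)) (Nat.cast_nonneg _)
  upper S i hi := by
    refine le_of_mul_le_mul_left ?_ (card_orientations_pos (d + 1))
    rw [mul_left_comm, card_orientations_mul_cornerSum_succ_real,
      card_orientations_mul_cornerSum_succ_real, Finset.mul_sum]
    refine Finset.sum_le_sum fun o ho => ?_
    rw [← Nat.cast_prod, ← Nat.cast_prod, prod_cornerSum_outSet hi,
      prod_cornerSum_outSet_insert S i, Nat.cast_mul, Nat.cast_mul, ← mul_assoc]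
    exact mul_le_mul_of_nonneg_right (h.upper _ i ((mem_orientations.1 ho).1 i)) (Nat.cast_nonneg _)

lemma CornerRatioBounds.of_le (h : CornerRatioBounds d n m M) (hm : 0 < m) {k : ℕ} (hk : n ≤ k) :
    CornerRatioBounds d k m M := by
  induction k, hk using Nat.le_induction with
  | base => exact h
  | succ k _ ih => exact ih.succ hm

/-- For `S = ∅` all weights are at most 1, and for `S = univ` at least 1; this sandwiches the
matching number. -/
lemma cornerSum_empty_le_numDimerMonomers (d n : ℕ) :
    cornerSum d n ∅ ≤ numDimerMonomers (sierpinskiGasket d n) := by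
  rw [numDimerMonomers_sierpinskiGasket, cornerSum, Finset.card_eq_sum_ones]
  refine Finset.sum_le_sum fun H _ => Finset.prod_le_one' fun i _ => ?_
  simp only [notMem_empty, decide_false, cornerWeight]
  cases decide (i ∈ coveredCorners d n H) <;> simp

lemma numDimerMonomers_le_cornerSum_univ (d n : ℕ) :
    numDimerMonomers (sierpinskiGasket d n) ≤ cornerSum d n univ := by
  rw [numDimerMonomers_sierpinskiGasket, cornerSum, Finset.card_eq_sum_ones]
  refine Finset.sum_le_sum fun H _ => Finset.one_le_prod' fun i _ => ?_
  simp only [mem_univ, decide_true, cornerWeight]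
  cases decide (i ∈ coveredCorners d n H) <;> simp

end Ratios

/-! ### Existence of the limit, with error bounds. -/

section Limit

/-- A sequence that is nearly multiplied by `5` at each step grows like `5 ^ n`. -/
lemma exists_tendsto_div_five_pow {u : ℕ → ℝ} {a b : ℝ} {N : ℕ}
    (hl : ∀ n ≥ N, 5 * u n + 10 * a ≤ u (n + 1)) (hu : ∀ n ≥ N, u (n + 1) ≤ 5 * u n + 10 * b) :
    ∃ l, Tendsto (fun n => u n / 5 ^ n) atTop (𝓝 l) ∧
      (u N + 5 / 2 * a) / 5 ^ N ≤ l ∧ l ≤ (u N + 5 / 2 * b) / 5 ^ N := by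
  -- The shift `5 / 2 * a` absorbs the term `10 * a`: `u + 5 / 2 * a` grows at least by the factor
  -- 5. So `p` increases, `q` decreases, and they enclose the limit.
  set p : ℕ → ℝ := fun k => (u (k + N) + 5 / 2 * a) / 5 ^ (k + N) with hp
  set q : ℕ → ℝ := fun k => (u (k + N) + 5 / 2 * b) / 5 ^ (k + N) with hq
  have hab : a ≤ b := by linarith [hl N le_rfl, hu N le_rfl]
  have hpm : Monotone p := monotone_nat_of_le_succ fun k => by
    simp only [hp]
    rw [div_le_div_iff₀ (by positivity) (by positivity), add_right_comm k 1 N, pow_succ]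
    have := hl (k + N) (by omega)
    have h5 : (0 : ℝ) < 5 ^ (k + N) := by positivity
    nlinarith
  have hqm : Antitone q := antitone_nat_of_succ_le fun k => by
    simp only [hq]
    rw [div_le_div_iff₀ (by positivity) (by positivity), add_right_comm k 1 N, pow_succ]
    have := hu (k + N) (by omega)
    have h5 : (0 : ℝ) < 5 ^ (k + N) := by positivity
    nlinarith
  have hpq : ∀ k, p k ≤ q 0 := fun k => by
    refine le_trans ?_ (hqm (Nat.zero_le k))
    simp only [hp, hq]
    gcongr
  have hbdd : BddAbove (Set.range p) := ⟨q 0, by rintro _ ⟨k, rfl⟩; exact hpq k⟩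
  have hlim := tendsto_atTop_ciSup hpm hbdd
  refine ⟨⨆ k, p k, ?_, ?_, ?_⟩
  · rw [← tendsto_add_atTop_iff_nat N]
    have h0 : Tendsto (fun k : ℕ => 5 / 2 * a * ((1 / 5 : ℝ) ^ (k + N))) atTop (𝓝 (5 / 2 * a * 0)) :=
      ((tendsto_add_atTop_iff_nat N).2
        (tendsto_pow_atTop_nhds_zero_of_lt_one (by norm_num) (by norm_num))).const_mul _
    have h1 := hlim.sub h0
    rw [mul_zero, sub_zero] at h1
    refine h1.congr fun k => ?_
    simp only [hp, one_div, inv_pow]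
    ring
  · have := le_ciSup hbdd 0
    simpa [hp] using this
  · have := ciSup_le hpq
    simpa [hq] using this

lemma tendsto_five_pow_div_card :
    Tendsto (fun n : ℕ => (5 : ℝ) ^ n / Nat.card (sierpinskiVerts 4 n)) atTop (𝓝 (2 / 5)) := by
  have hcard : ∀ n : ℕ, (Nat.card (sierpinskiVerts 4 n) : ℝ) = 5 / 2 * (5 ^ n + 1) := fun n => by
    have h := two_mul_card_sierpinskiVerts_four n
    rw [Nat.card_eq_fintype_card, Fintype.card_coe]
    have : (2 : ℝ) * #(sierpinskiVerts 4 n) = 5 * (5 ^ n + 1) := by exact_mod_cast h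
    linarith
  have h0 : Tendsto (fun n : ℕ => 5 / 2 * (1 + (1 / 5 : ℝ) ^ n)) atTop (𝓝 (5 / 2 * (1 + 0))) :=
    ((tendsto_pow_atTop_nhds_zero_of_lt_one (by norm_num) (by norm_num)).const_add 1).const_mul _
  have h1 := h0.inv₀ (by norm_num)
  rw [show (5 / 2 * (1 + 0) : ℝ)⁻¹ = 2 / 5 by norm_num] at h1
  refine h1.congr fun n => ?_
  rw [hcard, one_div, inv_pow]
  have h5 : (0 : ℝ) < 5 ^ n := by positivity
  field_simp

/-- Bounds on the ratios at one stage give the existence of the growth constant, and bounds for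
it. -/
theorem CornerRatioBounds.exists_growthConstant {N : ℕ} {m M : ℝ}
    (h : CornerRatioBounds 4 N m M) (hm : 0 < m) (hM : 0 < M) :
    ∃ z, IsDimerMonomerGrowthConstant 4 z ∧
      2 * Real.log (cornerSum 4 N ∅) + 5 * Real.log m ≤ 5 ^ (N + 1) * z ∧
      5 ^ (N + 1) * z ≤ 2 * Real.log (cornerSum 4 N ∅) + 5 * Real.log M := by
  have hpos : ∀ n ≥ N, (0 : ℝ) < cornerSum 4 n ∅ := fun n hn => by
    exact_mod_cast (h.of_le hm hn).pos
  obtain ⟨l, hlim, hl, hu⟩ := exists_tendsto_div_five_pow (N := N) (a := Real.log m)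
    (b := Real.log M) (u := fun n => Real.log (cornerSum 4 n ∅))
    (fun n hn => by
      have hc := hpos n hn
      have := Real.log_le_log (by positivity) ((h.of_le hm hn).pow_le_succ hm.le)
      rw [Real.log_mul (by positivity) (by positivity), Real.log_pow, Real.log_pow] at this
      norm_num at this
      linarith)
    (fun n hn => by
      have hc := hpos n hn
      have := Real.log_le_log (hpos (n + 1) (by omega)) ((h.of_le hm hn).succ_le_pow hM.le)
      rw [Real.log_mul (by positivity) (by positivity), Real.log_pow, Real.log_pow] at this
      norm_num at this
      linarith)
  have hN : Tendsto (fun n => Real.log (numDimerMonomers (sierpinskiGasket 4 n)) / 5 ^ n) atTop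
      (𝓝 l) := by
    have h0 : Tendsto (fun n : ℕ => 5 * Real.log M * (1 / 5 : ℝ) ^ n) atTop
        (𝓝 (5 * Real.log M * 0)) :=
      (tendsto_pow_atTop_nhds_zero_of_lt_one (by norm_num) (by norm_num)).const_mul _
    have h1 := hlim.add h0
    rw [mul_zero, add_zero] at h1
    refine tendsto_of_tendsto_of_tendsto_of_le_of_le' hlim h1 ?_ ?_
    · filter_upwards [eventually_ge_atTop N] with n hn
      have hc := hpos n hn
      gcongr
      exact cornerSum_empty_le_numDimerMonomers 4 n
    · filter_upwards [eventually_ge_atTop N] with n hn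
      have hc := hpos n hn
      have hle : (numDimerMonomers (sierpinskiGasket 4 n) : ℝ) ≤ M ^ 5 * cornerSum 4 n ∅ :=
        (Nat.cast_le.2 (numDimerMonomers_le_cornerSum_univ 4 n)).trans
          ((h.of_le hm hn).le_pow_mul hM.le univ)
      have hp : (0 : ℝ) < numDimerMonomers (sierpinskiGasket 4 n) :=
        hc.trans_le (Nat.cast_le.2 (cornerSum_empty_le_numDimerMonomers 4 n))
      have := Real.log_le_log hp hle
      rw [Real.log_mul (by positivity) (by positivity), Real.log_pow] at this
      push_cast at this
      rw [one_div, inv_pow, ← div_eq_mul_inv, ← add_div]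
      gcongr
      linarith
  -- The number of vertices is `5 / 2 * (5 ^ n + 1)`, hence the factor `2 / 5`.
  refine ⟨l * (2 / 5), ?_, ?_, ?_⟩
  · refine (hN.mul tendsto_five_pow_div_card).congr fun n => ?_
    have h5 : (5 : ℝ) ^ n ≠ 0 := by positivity
    rw [div_mul_div_cancel₀ h5]
  · rw [div_le_iff₀ (by positivity)] at hl
    rw [pow_succ]
    linarith
  · rw [le_div_iff₀ (by positivity)] at hu
    rw [pow_succ]
    linarith

end Limit

/-! ### Numerical evaluation at stage 4. -/

lemma cornerRatioBounds_four :
    CornerRatioBounds 4 4 (34746915146484 / 10 ^ 13) (34746915146485 / 10 ^ 13) := by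
  have key : ∀ k < 5, 34746915146484 * cornerValuesFour k ≤ 10 ^ 13 * cornerValuesFour (k + 1) ∧
      10 ^ 13 * cornerValuesFour (k + 1) ≤ 34746915146485 * cornerValuesFour k := by
    decide +kernel
  have hcard : ∀ (S : Finset (Fin 5)) (i : Fin 5), i ∉ S → #S < 5 := fun S i hi => by
    have := card_le_univ (insert i S)
    rw [card_insert_of_notMem hi, Fintype.card_fin] at this
    omega
  refine ⟨?_, fun S i hi => ?_, fun S i hi => ?_⟩
  · rw [cornerSum_four]
    decide +kernel
  · have := (key _ (hcard S i hi)).1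
    rw [cornerSum_four, cornerSum_four, card_insert_of_notMem hi, div_mul_eq_mul_div,
      div_le_iff₀ (by positivity), mul_comm _ ((10 : ℝ) ^ 13)]
    exact_mod_cast this
  · have := (key _ (hcard S i hi)).2
    rw [cornerSum_four, cornerSum_four, card_insert_of_notMem hi, div_mul_eq_mul_div,
      le_div_iff₀ (by positivity), mul_comm _ ((10 : ℝ) ^ 13)]
    exact_mod_cast this

/-- The rational lies just above the exponential of the endpoint, yet low enough for the integer
comparison in `lower_endpoint_bound`. The upper endpoint is treated symmetrically. -/
lemma exp_lower_endpoint_le : Real.exp 0.876779402949 ≤ 240314765974231 / 10 ^ 14 := by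
  refine (Real.exp_bound' (by norm_num) (by norm_num) (n := 18) (by norm_num)).trans ?_
  norm_num [Finset.sum_range_succ, Nat.factorial]

lemma le_exp_upper_endpoint : 240314765974470 / 10 ^ 14 ≤ Real.exp 0.876779402950 := by
  refine le_trans ?_ (Real.sum_le_exp_of_nonneg (by norm_num) 18)
  norm_num [Finset.sum_range_succ, Nat.factorial]

/-- The comparison of logarithms behind a comparison of natural numbers. -/
lemma log_expansion {q D x y E k : ℕ} (hq : 0 < q) (hD : 0 < D) (hx : 0 < x) (hy : 0 < y)
    (hE : 0 < E) :
    2 * Real.log x + 5 * Real.log (y / E) - k * Real.log (q / D) =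
      Real.log (D ^ k * (x ^ 2 * y ^ 5) : ℕ) - Real.log (q ^ k * E ^ 5 : ℕ) := by
  have hq' : (q : ℝ) ≠ 0 := by positivity
  have hD' : (D : ℝ) ≠ 0 := by positivity
  have hx' : (x : ℝ) ≠ 0 := by positivity
  have hy' : (y : ℝ) ≠ 0 := by positivity
  have hE' : (E : ℝ) ≠ 0 := by positivity
  simp only [Nat.cast_mul, Nat.cast_pow]
  rw [Real.log_div hy' hE', Real.log_div hq' hD', Real.log_mul (by positivity) (by positivity),
    Real.log_mul (by positivity) (by positivity), Real.log_mul (by positivity) (by positivity)]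
  simp only [Real.log_pow]
  push_cast
  ring

/-- Clearing denominators and exponentiating leaves an inequality of naturals that the kernel can
evaluate. -/
lemma mul_log_le_of_pow_le {q D x y E k : ℕ} (hq : 0 < q) (hD : 0 < D) (hx : 0 < x) (hy : 0 < y)
    (hE : 0 < E) (h : q ^ k * E ^ 5 ≤ D ^ k * (x ^ 2 * y ^ 5)) :
    k * Real.log (q / D) ≤ 2 * Real.log x + 5 * Real.log (y / E) := by
  have h1 := Real.log_le_log (Nat.cast_pos.2 (by positivity)) (Nat.cast_le (α := ℝ).2 h)
  rwa [← sub_nonneg, ← log_expansion hq hD hx hy hE, sub_nonneg] at h1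

lemma lt_mul_log_of_lt_pow {q D x y E k : ℕ} (hq : 0 < q) (hD : 0 < D) (hx : 0 < x) (hy : 0 < y)
    (hE : 0 < E) (h : D ^ k * (x ^ 2 * y ^ 5) < q ^ k * E ^ 5) :
    2 * Real.log x + 5 * Real.log (y / E) < k * Real.log (q / D) := by
  have h1 := Real.log_lt_log (Nat.cast_pos.2 (by positivity)) (Nat.cast_lt (α := ℝ).2 h)
  rwa [← sub_neg, ← log_expansion hq hD hx hy hE, sub_neg] at h1

lemma cornerSum_four_empty : cornerSum 4 4 ∅ = cornerValuesFour 0 := cornerSum_four ∅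

/-- The factor 3125 is `5 ^ (N + 1)` for `N = 4`. -/
lemma lower_endpoint_bound : 3125 * (0.876779402949 : ℝ) ≤
    2 * Real.log (cornerSum 4 4 ∅) + 5 * Real.log (34746915146484 / 10 ^ 13) := by
  have key : 240314765974231 ^ 3125 * (10 ^ 13) ^ 5 ≤
      (10 ^ 14) ^ 3125 * (cornerValuesFour 0 ^ 2 * 34746915146484 ^ 5) := by
    decide +kernel
  -- Folding the literal back keeps the huge number symbolic under the logarithm.
  rw [← cornerSum_four_empty] at key
  have h1 := mul_log_le_of_pow_le (by norm_num) (by norm_num) cornerRatioBounds_four.pos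
    (by norm_num) (by norm_num) key
  have h2 := (Real.le_log_iff_exp_le (by positivity)).2 exp_lower_endpoint_le
  push_cast at h1
  linarith

lemma upper_endpoint_bound :
    2 * Real.log (cornerSum 4 4 ∅) + 5 * Real.log (34746915146485 / 10 ^ 13) <
      3125 * (0.876779402950 : ℝ) := by
  have key : (10 ^ 14) ^ 3125 * (cornerValuesFour 0 ^ 2 * 34746915146485 ^ 5) <
      240314765974470 ^ 3125 * (10 ^ 13) ^ 5 := by
    decide +kernel
  rw [← cornerSum_four_empty] at key
  have h1 := lt_mul_log_of_lt_pow (by norm_num) (by norm_num) cornerRatioBounds_four.pos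
    (by norm_num) (by norm_num) key
  have h2 := (Real.log_le_iff_le_exp (by positivity)).2 le_exp_upper_endpoint
  push_cast at h1
  linarith

theorem proposition4 :
    ∃ z : ℝ, IsDimerMonomerGrowthConstant 4 z ∧
      (0.876779402949 : ℝ) ≤ z ∧ z < (0.876779402950 : ℝ) := by
  obtain ⟨z, hz, hl, hu⟩ := cornerRatioBounds_four.exists_growthConstant
    (by norm_num) (by norm_num)
  have h1 := lower_endpoint_bound.trans hl
  have h2 := hu.trans_lt upper_endpoint_bound
  norm_num at h1 h2
  exact ⟨z, hz, by linarith, by linarith⟩
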